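/- Let $X \in \mathbb{C}^{N \times T}$ be a matrix of rank $r$ with $1 \le r < \min\{N,T\}$, and let $X = U \Sigma V^{*}$ be its thin singular value decomposition, where $U \in \mathbb{C}^{N \times r}$ and $V \in \mathbb{C}^{T \times r}$ have orthonormal columns and $\Sigma$ is the $r \times r$ diagonal matrix of the positive singular values. For a matrix $A$ put $\|A\|_{2,\infty} := \max_i \big(\sum_j |A(i,j)|^2\big)^{1/2}$. Suppose that $X$ is $\{\mu_1,\mu_2\}$-incoherent, that is, $1 \le \mu_1 \le N/r$, $1 \le \mu_2 \le T/r$ and $$\|U\|_{2,\infty} \le \sqrt{\frac{\mu_1 r}{N}}, \qquad \|V\|_{2,\infty} \le \sqrt{\frac{\mu_2 r}{T}}.$$ Draw a set $\mathcal{I}$ of row indices of prescribed size $|\mathcal{I}| \le N$ uniformly without replacement and, independently, a set $\mathcal{J}$ of column indices of prescribed size $|\mathcal{J}| \le T$ uniformly without replacement, and let $X_R = X(\mathcal{I}, :)$ and $X_{RC} = X(\mathcal{I}, \mathcal{J})$ be the corresponding submatrices. If, for some $0 < \delta < 1$ and $0 < \epsilon < 1$, $$|\mathcal{I}| \ge 3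 r \mu_1 \frac{\ln(2r/\delta)}{\epsilon^2}, \qquad |\mathcal{J}| \ge 3 r \mu_2 \frac{\ln(2r/\delta)}{\epsilon^2},$$ then $\mathrm{rank}(X_R) = r$ with probability at least $1-\delta$, and $\mathrm{rank}(X_{RC}) = r$ with probability at least $(1-\delta)^2$. -/

import Mathlib

open Matrix

/-- The norm `‖A‖_{2,∞}`: the largest Euclidean norm of a row of `A`. -/
noncomputable def twoInftyNorm {n r : ℕ} (A : Matrix (Fin n) (Fin r) ℂ) : ℝ :=
  ⨆ i : Fin n, Real.sqrt (∑ j : Fin r, ‖A i j‖ ^ 2)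

/-- `X = U * diag σ * Vᴴ` is a thin singular value decomposition with `r` positive
singular values: `U` and `V` have orthonormal columns. -/
structure IsThinSVD {N T r : ℕ} (X : Matrix (Fin N) (Fin T) ℂ)
    (U : Matrix (Fin N) (Fin r) ℂ) (σ : Fin r → ℝ) (V : Matrix (Fin T) (Fin r) ℂ) : Prop where
  orthonormal_left : Uᴴ * U = 1
  orthonormal_right : Vᴴ * V = 1
  pos : ∀ k, 0 < σ k
  antitone : Antitone σ
  eq_mul : X = U * Matrix.diagonal (fun k => (σ k : ℂ)) * Vᴴ

/-- `{μ₁, μ₂}`-incoherence of a rank-`r` matrix `X`. The row norms of `U` and `V` are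
the same for all thin singular value decompositions of `X` (`U * Uᴴ` and `V * Vᴴ` are the
orthogonal projections onto the column space of `X` and of `Xᴴ`), so it does not matter which
decomposition is used. -/
structure IsIncoherent {N T : ℕ} (X : Matrix (Fin N) (Fin T) ℂ) (r : ℕ) (μ₁ μ₂ : ℝ) : Prop where
  one_le_left : 1 ≤ μ₁
  le_left : μ₁ ≤ (N : ℝ) / r
  one_le_right : 1 ≤ μ₂
  le_right : μ₂ ≤ (T : ℝ) / r
  norm_le : ∃ (U : Matrix (Fin N) (Fin r) ℂ) (σ : Fin r → ℝ) (V : Matrix (Fin T) (Fin r) ℂ),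
    IsThinSVD X U σ V ∧
      twoInftyNorm U ≤ Real.sqrt (μ₁ * r / N) ∧ twoInftyNorm V ≤ Real.sqrt (μ₂ * r / T)

/-- `m` of `n` indices drawn uniformly without replacement: the uniform distribution on the
`m`-element subsets of `Fin n`. -/
noncomputable def sampleWithoutReplacement {m n : ℕ} (h : m ≤ n) : PMF (Finset (Fin n)) :=
  PMF.uniformOfFinset (Finset.powersetCard m (Finset.univ : Finset (Fin n)))
    (Finset.powersetCard_nonempty.2 (by simpa using h))

/-- The joint distribution of the row set `I` and the column set `J`: first `m` of `N` rows are
drawn uniformly without replacement, then, independently of them, `n` of `T` columns. -/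
noncomputable def sampleRowsCols {m N n T : ℕ} (hm : m ≤ N) (hn : n ≤ T) :
    PMF (Finset (Fin N) × Finset (Fin T)) :=
  (sampleWithoutReplacement hm).bind fun I =>
    (sampleWithoutReplacement hn).map fun J => (I, J)

/-- The row submatrix `X(I, :)`. -/
def rowSubmatrix {N T : ℕ} (X : Matrix (Fin N) (Fin T) ℂ) (I : Finset (Fin N)) :
    Matrix {i // i ∈ I} (Fin T) ℂ :=
  X.submatrix Subtype.val id

/-- The submatrix `X(I, J)`. -/
def rowColSubmatrix {N T : ℕ} (X : Matrix (Fin N) (Fin T) ℂ) (I : Finset (Fin N))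
    (J : Finset (Fin T)) : Matrix {i // i ∈ I} {j // j ∈ J} ℂ :=
  X.submatrix Subtype.val Subtype.val

/-! The conjugated rows `v i` of `U` form a Parseval frame of `ℂ^r` with `‖v i‖² ≤ c = μr/N`. Let
`d(I)` be the codimension of the span of the sampled vectors. Projecting the frame to the orthogonal
complement of that span shows that at least `d(I)/c` of the `v i` lie outside it, so one further
random index lowers the expected codimension by a factor `1 - 1/(cN) = 1 - 1/(μr)` or better
(`sum_compl_spanCodim_insert_le`). After `m` draws the expectation is at most `r exp(-m/(μr)) ≤
δ/2`, and Markov's inequality bounds the probability that `d ≠ 0`. No matrix concentration is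
involved.

The same holds for `V`. Since `X_R = U_I Σ Vᴴ` and `X_RC = U_I Σ V_Jᴴ`, full column rank of the
sampled factors gives rank `r`, and independence multiplies the two probabilities. -/

open Module in
/-- If a Parseval frame has vectors of squared norm at most `c`, then the codimension of a subspace
is at most `c` times the number of frame vectors outside it. -/
theorem finrank_orthogonal_le_mul_card_notMem {ι E : Type*} [Fintype ι] [NormedAddCommGroup E]
    [InnerProductSpace ℂ E] [FiniteDimensional ℂ E] (v : ι → E)
    (hv : ∀ e, ∑ i, ‖inner ℂ (v i) e‖ ^ 2 = ‖e‖ ^ 2) {c : ℝ} (hc : ∀ i, ‖v i‖ ^ 2 ≤ c)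
    (W : Submodule ℂ E) [DecidablePred fun i => v i ∉ W] :
    (finrank ℂ Wᗮ : ℝ) ≤ c * (Finset.univ.filter fun i => v i ∉ W).card := by
  let b := stdOrthonormalBasis ℂ Wᗮ
  have hb : Orthonormal ℂ fun a => (b a : E) := b.orthonormal.comp_linearIsometry Wᗮ.subtypeₗᵢ
  -- Parseval at each unit vector `b a`, summed over the basis. Below, frame vectors in `W`
  -- contribute nothing and Bessel bounds each of the others by `c`.
  have key : (finrank ℂ Wᗮ : ℝ) = ∑ i, ∑ a, ‖inner ℂ (b a : E) (v i)‖ ^ 2 := by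
    rw [Finset.sum_comm]
    have h : ∀ a, ∑ i, ‖inner ℂ (b a : E) (v i)‖ ^ 2 = 1 := fun a => by
      have := hv (b a)
      rw [hb.1 a, one_pow] at this
      rw [← this]
      exact Finset.sum_congr rfl fun i _ => by rw [norm_inner_symm]
    simp [h]
  rw [key, ← Finset.sum_subset (Finset.subset_univ (Finset.univ.filter fun i => v i ∉ W))]
  · rw [mul_comm, ← nsmul_eq_mul]
    exact Finset.sum_le_card_nsmul _ _ _ fun i _ =>
      (hb.sum_inner_products_le (s := Finset.univ) (v i)).trans (hc i)
  · intro i _ hi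
    have hi : v i ∈ W := by simpa using hi
    refine Finset.sum_eq_zero fun a _ => ?_
    rw [W.inner_left_of_mem_orthogonal hi (b a).2]
    simp

/-- Double counting of pairs (set, marked element) by erasing or inserting that element. It lets a
uniform `(k+1)`-set be drawn as a uniform `k`-set followed by one new index. -/
theorem sum_powersetCard_succ_mul {ι : Type*} [Fintype ι] [DecidableEq ι] (f : Finset ι → ℝ)
    (k : ℕ) :
    ((k : ℝ) + 1) * ∑ I ∈ Finset.powersetCard (k + 1) Finset.univ, f I =
      ∑ J ∈ Finset.powersetCard k Finset.univ, ∑ i ∈ Jᶜ, f (insert i J) := by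
  have h : ((k : ℝ) + 1) * ∑ I ∈ Finset.powersetCard (k + 1) (Finset.univ : Finset ι), f I =
      ∑ I ∈ Finset.powersetCard (k + 1) (Finset.univ : Finset ι), ∑ _i ∈ I, f I := by
    rw [Finset.mul_sum]
    refine Finset.sum_congr rfl fun I hI => ?_
    rw [Finset.sum_const, (Finset.mem_powersetCard.1 hI).2, nsmul_eq_mul]
    push_cast
    ring
  rw [h, Finset.sum_sigma', Finset.sum_sigma']
  refine Finset.sum_bij' (fun p _ => ⟨p.1.erase p.2, p.2⟩) (fun p _ => ⟨insert p.2 p.1, p.2⟩)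
    ?_ ?_ ?_ ?_ ?_
  · rintro ⟨I, i⟩ h
    simp only [Finset.mem_sigma, Finset.mem_powersetCard] at h
    simp [Finset.mem_powersetCard, Finset.card_erase_of_mem h.2, h.1.2]
  · rintro ⟨J, i⟩ h
    simp only [Finset.mem_sigma, Finset.mem_powersetCard, Finset.mem_compl] at h
    simp [Finset.mem_powersetCard, Finset.card_insert_of_notMem h.2, h.1.2]
  · rintro ⟨I, i⟩ h
    simp only [Finset.mem_sigma] at h
    simp [Finset.insert_erase h.2]
  · rintro ⟨J, i⟩ h
    simp only [Finset.mem_sigma, Finset.mem_compl] at h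
    simp [Finset.erase_insert h.2]
  · rintro ⟨I, i⟩ h
    simp only [Finset.mem_sigma] at h
    simp [Finset.insert_erase h.2]

open Module in
/-- The codimension of the span of the vectors `v i`, `i ∈ I`. -/
noncomputable def spanCodim {ι E : Type*} [NormedAddCommGroup E] [InnerProductSpace ℂ E]
    (v : ι → E) (I : Finset ι) : ℕ :=
  finrank ℂ (Submodule.span ℂ (v '' I))ᗮ

section SpanCodim

variable {ι E : Type*} [NormedAddCommGroup E] [InnerProductSpace ℂ E] [FiniteDimensional ℂ E]

open Module in
theorem spanCodim_insert_add_le [DecidableEq ι] (v : ι → E) (I : Finset ι) (i : ι)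
    [Decidable (v i ∉ Submodule.span ℂ (v '' I))] :
    spanCodim v (insert i I) + (if v i ∉ Submodule.span ℂ (v '' I) then 1 else 0) ≤
      spanCodim v I := by
  have h1 := (Submodule.span ℂ (v '' I)).finrank_add_finrank_orthogonal
  have h2 := (Submodule.span ℂ (v '' (insert i I : Finset ι))).finrank_add_finrank_orthogonal
  have hle : Submodule.span ℂ (v '' I) ≤ Submodule.span ℂ (v '' (insert i I : Finset ι)) :=
    Submodule.span_mono (Set.image_mono (by simp))
  unfold spanCodim
  split_ifs with hi
  · have := Submodule.finrank_mono hle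
    omega
  · have hlt : Submodule.span ℂ (v '' I) < Submodule.span ℂ (v '' (insert i I : Finset ι)) :=
      lt_of_le_of_ne hle fun h => hi (by
        rw [h]
        exact Submodule.subset_span ⟨i, by simp, rfl⟩)
    have := Submodule.finrank_lt_finrank_of_lt hlt
    omega

variable [Fintype ι] [DecidableEq ι]

theorem sum_compl_spanCodim_insert_le (v : ι → E)
    (hv : ∀ e, ∑ i, ‖inner ℂ (v i) e‖ ^ 2 = ‖e‖ ^ 2) {c : ℝ} (hc₀ : 0 < c)
    (hc : ∀ i, ‖v i‖ ^ 2 ≤ c) (J : Finset ι) :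
    ∑ i ∈ Jᶜ, (spanCodim v (insert i J) : ℝ) ≤
      (Jᶜ.card : ℝ) * (1 - 1 / (c * Fintype.card ι)) * spanCodim v J := by
  classical
  set W := Submodule.span ℂ (v '' J) with hW
  have h1 : ∑ i ∈ Jᶜ, ((spanCodim v (insert i J) : ℝ) + if v i ∉ W then 1 else 0) ≤
      (Jᶜ.card : ℝ) * spanCodim v J := by
    rw [← nsmul_eq_mul]
    refine Finset.sum_le_card_nsmul _ _ _ fun i _ => ?_
    have := spanCodim_insert_add_le v J i
    rw [← hW] at this
    exact_mod_cast this
  have h2 : ∑ i ∈ Jᶜ, (if v i ∉ W then (1 : ℝ) else 0) =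
      (Finset.univ.filter fun i => v i ∉ W).card := by
    rw [Finset.sum_subset (Finset.subset_univ Jᶜ), Finset.sum_boole]
    intro i _ hi
    have hi : i ∈ J := by simpa using hi
    have hiW : v i ∈ W := Submodule.subset_span ⟨i, hi, rfl⟩
    rw [if_neg (not_not.2 hiW)]
  have h3 : (spanCodim v J : ℝ) ≤ c * (Finset.univ.filter fun i => v i ∉ W).card :=
    finrank_orthogonal_le_mul_card_notMem v hv hc W
  rw [Finset.sum_add_distrib, h2] at h1
  -- Every index with `v i ∉ W` lies in `Jᶜ`, so sampling without replacement can only raise its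
  -- chance; replacing `|Jᶜ|` by `|ι|` makes the contraction factor independent of `J`.
  have h4 : (Jᶜ.card : ℝ) / Fintype.card ι ≤ 1 :=
    div_le_one_of_le₀ (by exact_mod_cast Finset.card_le_univ _) (Nat.cast_nonneg _)
  have h5 : (Jᶜ.card : ℝ) * (1 / (c * Fintype.card ι)) * spanCodim v J ≤
      (Finset.univ.filter fun i => v i ∉ W).card := by
    calc (Jᶜ.card : ℝ) * (1 / (c * Fintype.card ι)) * spanCodim v J
        = (Jᶜ.card : ℝ) / Fintype.card ι * (spanCodim v J / c) := by
          rw [one_div, mul_inv]; ring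
      _ ≤ 1 * (spanCodim v J / c) := by gcongr
      _ ≤ _ := by rw [one_mul, div_le_iff₀ hc₀, mul_comm]; exact h3
  linarith

open Module in
theorem sum_powersetCard_spanCodim_le (v : ι → E)
    (hv : ∀ e, ∑ i, ‖inner ℂ (v i) e‖ ^ 2 = ‖e‖ ^ 2) {c : ℝ} (hc₀ : 0 < c)
    (hc : ∀ i, ‖v i‖ ^ 2 ≤ c) (hcN : 1 ≤ c * Fintype.card ι) (k : ℕ) :
    ∑ I ∈ Finset.powersetCard k Finset.univ, (spanCodim v I : ℝ) ≤
      (Fintype.card ι).choose k * (finrank ℂ E * (1 - 1 / (c * Fintype.card ι)) ^ k) := by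
  set q : ℝ := 1 - 1 / (c * Fintype.card ι)
  have hq₀ : 0 ≤ q := by
    have := div_le_one_of_le₀ hcN (by linarith)
    linarith
  induction k with
  | zero => simpa [spanCodim] using Submodule.finrank_le _
  | succ k ih =>
    have hk : (0 : ℝ) < (k : ℝ) + 1 := by positivity
    refine le_of_mul_le_mul_left ?_ hk
    rw [sum_powersetCard_succ_mul]
    calc ∑ J ∈ Finset.powersetCard k Finset.univ, ∑ i ∈ Jᶜ, (spanCodim v (insert i J) : ℝ)
        ≤ ∑ J ∈ Finset.powersetCard k (Finset.univ : Finset ι),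
            ((Fintype.card ι - k : ℕ) : ℝ) * q * spanCodim v J := by
          refine Finset.sum_le_sum fun J hJ => ?_
          have := sum_compl_spanCodim_insert_le v hv hc₀ hc J
          rwa [Finset.card_compl, (Finset.mem_powersetCard.1 hJ).2] at this
      _ = ((Fintype.card ι - k : ℕ) : ℝ) * q *
            ∑ J ∈ Finset.powersetCard k (Finset.univ : Finset ι), (spanCodim v J : ℝ) := by
          rw [Finset.mul_sum]
      _ ≤ ((Fintype.card ι - k : ℕ) : ℝ) * q *
            ((Fintype.card ι).choose k * (finrank ℂ E * q ^ k)) := by gcongr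
      _ = (((Fintype.card ι).choose k * (Fintype.card ι - k) : ℕ) : ℝ) *
            (finrank ℂ E * q ^ (k + 1)) := by push_cast; ring
      _ = _ := by
          rw [← Nat.choose_succ_right_eq]
          push_cast
          ring

open Module in
theorem card_spanCodim_ne_zero_le (v : ι → E)
    (hv : ∀ e, ∑ i, ‖inner ℂ (v i) e‖ ^ 2 = ‖e‖ ^ 2) {c : ℝ} (hc₀ : 0 < c)
    (hc : ∀ i, ‖v i‖ ^ 2 ≤ c) (hcN : 1 ≤ c * Fintype.card ι) (k : ℕ) :
    (((Finset.powersetCard k Finset.univ).filter fun I => spanCodim v I ≠ 0).card : ℝ) ≤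
      (Fintype.card ι).choose k * (finrank ℂ E * Real.exp (-(k / (c * Fintype.card ι)))) := by
  -- Markov's inequality: a nonzero codimension is at least 1.
  have h1 : (((Finset.powersetCard k Finset.univ).filter fun I => spanCodim v I ≠ 0).card : ℝ) ≤
      ∑ I ∈ Finset.powersetCard k Finset.univ, (spanCodim v I : ℝ) := by
    rw [Finset.card_filter]
    push_cast
    refine Finset.sum_le_sum fun I _ => ?_
    split_ifs with h
    · exact_mod_cast Nat.one_le_iff_ne_zero.2 h
    · positivity
  refine (h1.trans (sum_powersetCard_spanCodim_le v hv hc₀ hc hcN k)).trans ?_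
  have hq₀ : 0 ≤ 1 - 1 / (c * Fintype.card ι) := by
    have := div_le_one_of_le₀ hcN (by linarith)
    linarith
  have h2 : (1 - 1 / (c * Fintype.card ι)) ^ k ≤ Real.exp (-(k / (c * Fintype.card ι))) := by
    calc (1 - 1 / (c * Fintype.card ι)) ^ k
        ≤ Real.exp (-(1 / (c * Fintype.card ι))) ^ k := by
          gcongr
          exact Real.one_sub_le_exp_neg _
      _ = _ := by rw [← Real.exp_nat_mul]; ring_nf
  gcongr

end SpanCodim

/-- The inner product is conjugate-linear on the left, so `star` makes `inner (v i) x = (U x) i`: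
the kernel of the row submatrix is orthogonal to all sampled `v i`. -/
theorem rank_submatrix_eq_of_spanCodim_eq_zero {n r : ℕ} (U : Matrix (Fin n) (Fin r) ℂ)
    (I : Finset (Fin n))
    (h : spanCodim (fun i => WithLp.toLp 2 fun j => star (U i j) :
      Fin n → EuclideanSpace ℂ (Fin r)) I = 0) :
    (U.submatrix (Subtype.val : {i // i ∈ I} → Fin n) id).rank = r := by
  rw [spanCodim, Submodule.finrank_eq_zero] at h
  rw [Matrix.rank, LinearMap.finrank_range_of_inj, Module.finrank_fin_fun]
  rw [← LinearMap.ker_eq_bot, LinearMap.ker_eq_bot']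
  intro x hx
  have hmem : (WithLp.toLp 2 x : EuclideanSpace ℂ (Fin r)) ∈ (Submodule.span ℂ
      ((fun i => WithLp.toLp 2 fun j => star (U i j) :
        Fin n → EuclideanSpace ℂ (Fin r)) '' I))ᗮ := by
    rw [Submodule.mem_orthogonal]
    intro u hu
    induction hu using Submodule.span_induction with
    | mem u hu =>
      obtain ⟨i, hi, rfl⟩ := hu
      have := congrFun hx ⟨i, hi⟩
      simp only [Matrix.mulVecLin_apply, Matrix.mulVec, dotProduct, Matrix.submatrix_apply, id,
        Pi.zero_apply] at this
      simpa [PiLp.inner_apply, mul_comm] using this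
    | zero => simp
    | add a b _ _ ha hb => rw [inner_add_left, ha, hb, add_zero]
    | smul a b _ hb => rw [inner_smul_left, hb, mul_zero]
  rw [h, Submodule.mem_bot] at hmem
  simpa using congrArg WithLp.ofLp hmem

theorem sum_norm_inner_conj_row_sq {n r : ℕ} {U : Matrix (Fin n) (Fin r) ℂ} (hU : Uᴴ * U = 1)
    (e : EuclideanSpace ℂ (Fin r)) :
    ∑ i, ‖inner ℂ (WithLp.toLp 2 fun j => star (U i j) : EuclideanSpace ℂ (Fin r)) e‖ ^ 2 =
      ‖e‖ ^ 2 := by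
  have h1 : ∀ i, inner ℂ (WithLp.toLp 2 fun j => star (U i j) : EuclideanSpace ℂ (Fin r)) e =
      (U *ᵥ e.ofLp) i := fun i => by
    simp [PiLp.inner_apply, Matrix.mulVec, dotProduct, mul_comm]
  simp only [h1]
  have h2 : star (U *ᵥ e.ofLp) ⬝ᵥ (U *ᵥ e.ofLp) = star e.ofLp ⬝ᵥ e.ofLp := by
    rw [Matrix.star_mulVec, Matrix.dotProduct_mulVec, Matrix.vecMul_vecMul, hU, Matrix.vecMul_one]
  rw [EuclideanSpace.norm_sq_eq]
  have h3 : ∀ {m : ℕ} (x : Fin m → ℂ), star x ⬝ᵥ x = ((∑ i, ‖x i‖ ^ 2 : ℝ) : ℂ) := fun x => by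
    simp [dotProduct, Complex.conj_mul']
  rw [h3, h3] at h2
  exact_mod_cast h2

theorem norm_row_sq_le_of_twoInftyNorm_le {n r : ℕ} {U : Matrix (Fin n) (Fin r) ℂ} {c : ℝ}
    (hc : 0 ≤ c) (hU : twoInftyNorm U ≤ Real.sqrt c) (i : Fin n) :
    ‖(WithLp.toLp 2 fun j => star (U i j) : EuclideanSpace ℂ (Fin r))‖ ^ 2 ≤ c := by
  have h := (le_ciSup (Set.finite_range fun i => Real.sqrt (∑ j, ‖U i j‖ ^ 2)).bddAbove i).trans hU
  rw [Real.sqrt_le_sqrt_iff hc] at h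
  rw [EuclideanSpace.norm_sq_eq]
  simpa using h

/-- A uniform sample of rows of a matrix with orthonormal columns and small rows has full column
rank with high probability. -/
theorem le_prob_rank_submatrix_eq {N r m : ℕ} (hr : 1 ≤ r) (hN : 0 < N)
    {U : Matrix (Fin N) (Fin r) ℂ} (hU : Uᴴ * U = 1) {μ δ : ℝ} (hμ : 1 ≤ μ)
    (hUμ : twoInftyNorm U ≤ Real.sqrt (μ * r / N)) (hδ : 0 < δ) (hmN : m ≤ N)
    (hm : r * μ * Real.log (2 * r / δ) ≤ m) :
    ENNReal.ofReal (1 - δ) ≤ (sampleWithoutReplacement hmN).toOuterMeasure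
      {I | (U.submatrix (Subtype.val : {i // i ∈ I} → Fin N) id).rank = r} := by
  classical
  have hr' : (1 : ℝ) ≤ r := by exact_mod_cast hr
  have hN' : (0 : ℝ) < N := by exact_mod_cast hN
  have hc₀ : 0 < μ * r / N := by positivity
  have hcN : μ * r / N * N = μ * r := by field_simp
  have hμr : 1 ≤ μ * r := one_le_mul_of_one_le_of_one_le hμ hr'
  let v : Fin N → EuclideanSpace ℂ (Fin r) := fun i => WithLp.toLp 2 fun j => star (U i j)
  have hbad := card_spanCodim_ne_zero_le v (sum_norm_inner_conj_row_sq hU) hc₀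
    (norm_row_sq_le_of_twoInftyNorm_le hc₀.le hUμ) (by simpa [hcN] using hμr) m
  rw [Fintype.card_fin, hcN, finrank_euclideanSpace_fin] at hbad
  have hexp : (r : ℝ) * Real.exp (-(m / (μ * r))) ≤ δ := by
    have h1 : Real.log (2 * r / δ) ≤ m / (μ * r) := by
      rw [le_div_iff₀ (by positivity)]
      linarith
    calc (r : ℝ) * Real.exp (-(m / (μ * r))) ≤ r * Real.exp (-Real.log (2 * r / δ)) := by gcongr
      _ = δ / 2 := by
        rw [Real.exp_neg, Real.exp_log (by positivity)]
        field_simp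
      _ ≤ δ := by linarith
  have hcard := Finset.card_filter_add_card_filter_not (s := Finset.powersetCard m Finset.univ)
    fun I => spanCodim v I = 0
  rw [Finset.card_powersetCard, Finset.card_fin] at hcard
  have hgood : (N.choose m : ℝ) * (1 - δ) ≤
      ((Finset.powersetCard m Finset.univ).filter fun I => spanCodim v I = 0).card := by
    have h1 : (N.choose m : ℝ) * (r * Real.exp (-(m / (μ * r)))) ≤ N.choose m * δ := by gcongr
    have h2 := congrArg (Nat.cast (R := ℝ)) hcard
    push_cast at h2
    simp only [ne_eq] at hbad
    linarith
  have hmono : {I | spanCodim v I = 0} ⊆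
      {I | (U.submatrix (Subtype.val : {i // i ∈ I} → Fin N) id).rank = r} := fun I hI =>
    rank_submatrix_eq_of_spanCodim_eq_zero U I hI
  refine le_trans ?_ (MeasureTheory.measure_mono hmono)
  rw [sampleWithoutReplacement, PMF.toOuterMeasure_uniformOfFinset_apply, Finset.card_powersetCard,
    Finset.card_fin, ENNReal.le_div_iff_mul_le (by simp [(Nat.choose_pos hmN).ne'])
    (by simp), ← ENNReal.ofReal_natCast, ← ENNReal.ofReal_natCast,
    ← ENNReal.ofReal_mul' (by positivity)]
  refine ENNReal.ofReal_le_ofReal ?_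
  rw [mul_comm]
  simpa using hgood

/-- Condition on the first draw: for `a ∈ E` the slice of `S` over `a` contains `F`; other `a` are
discarded. -/
theorem mul_toOuterMeasure_le_of_prod_subset {α β : Type*} (p : PMF α) (q : PMF β) {E : Set α}
    {F : Set β} {S : Set (α × β)} (h : E ×ˢ F ⊆ S) :
    p.toOuterMeasure E * q.toOuterMeasure F ≤
      (p.bind fun a => q.map fun b => (a, b)).toOuterMeasure S := by
  rw [PMF.toOuterMeasure_bind_apply, PMF.toOuterMeasure_apply, ← ENNReal.tsum_mul_right]
  refine ENNReal.tsum_le_tsum fun a => ?_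
  by_cases ha : a ∈ E
  · rw [Set.indicator_of_mem ha, PMF.toOuterMeasure_map_apply]
    gcongr
    exact fun b hb => h ⟨ha, hb⟩
  · simp [Set.indicator_of_notMem ha]

theorem isUnit_of_rank_eq_card {n : ℕ} {A : Matrix (Fin n) (Fin n) ℂ} (h : A.rank = n) :
    IsUnit A := by
  rw [← Matrix.mulVec_surjective_iff_isUnit]
  have htop : LinearMap.range A.mulVecLin = ⊤ := Submodule.eq_top_of_finrank_eq (by
    rw [Module.finrank_fin_fun]
    exact h)
  exact LinearMap.range_eq_top.1 htop

open ComplexOrder in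
theorem rank_eq_of_conjTranspose_mul_self_eq_one {n r : ℕ} {V : Matrix (Fin n) (Fin r) ℂ}
    (h : Vᴴ * V = 1) : V.rank = r := by
  rw [← Matrix.rank_conjTranspose_mul_self, h, Matrix.rank_one, Fintype.card_fin]

open ComplexOrder in
/-- A product `A * D * Bᴴ` with `A` and `B` of full column rank and `D` invertible has full rank. -/
theorem rank_mul_mul_conjTranspose {α β : Type*} [Fintype α] [Fintype β] {r : ℕ}
    {A : Matrix α (Fin r) ℂ} {D : Matrix (Fin r) (Fin r) ℂ} {B : Matrix β (Fin r) ℂ}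
    (hA : A.rank = r) (hD : IsUnit D) (hB : B.rank = r) : (A * D * Bᴴ).rank = r := by
  refine le_antisymm ?_ ?_
  · rw [Matrix.mul_assoc]
    exact (Matrix.rank_mul_le_left _ _).trans hA.le
  -- The Gram matrices are invertible, so `Aᴴ (A D Bᴴ) B` has rank `r`, which the middle factor must
  -- attain.
  · have hu : IsUnit (Aᴴ * A * D * (Bᴴ * B)) :=
      ((isUnit_of_rank_eq_card (by rw [Matrix.rank_conjTranspose_mul_self, hA])).mul hD).mul
        (isUnit_of_rank_eq_card (by rw [Matrix.rank_conjTranspose_mul_self, hB]))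
    have hrank := Matrix.rank_of_isUnit _ hu
    rw [Fintype.card_fin] at hrank
    have heq : Aᴴ * A * D * (Bᴴ * B) = Aᴴ * ((A * D * Bᴴ) * B) := by
      simp only [Matrix.mul_assoc]
    rw [heq] at hrank
    calc r = _ := hrank.symm
      _ ≤ _ := Matrix.rank_mul_le_right _ _
      _ ≤ _ := Matrix.rank_mul_le_left _ _

theorem lemma1 {N T r : ℕ} (hr : 1 ≤ r) (hrN : r < N) (hrT : r < T)
    (X : Matrix (Fin N) (Fin T) ℂ) (hX : X.rank = r)
    (μ₁ μ₂ : ℝ) (hμ : IsIncoherent X r μ₁ μ₂)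
    (δ ε : ℝ) (hδ₀ : 0 < δ) (hδ₁ : δ < 1) (hε₀ : 0 < ε) (hε₁ : ε < 1)
    (m n : ℕ) (hmN : m ≤ N) (hnT : n ≤ T)
    (hm : 3 * r * μ₁ * (Real.log (2 * r / δ) / ε ^ 2) ≤ (m : ℝ))
    (hn : 3 * r * μ₂ * (Real.log (2 * r / δ) / ε ^ 2) ≤ (n : ℝ)) :
    ENNReal.ofReal (1 - δ) ≤
        (sampleRowsCols hmN hnT).toOuterMeasure {p | (rowSubmatrix X p.1).rank = r} ∧
      ENNReal.ofReal ((1 - δ) ^ 2) ≤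
        (sampleRowsCols hmN hnT).toOuterMeasure {p | (rowColSubmatrix X p.1 p.2).rank = r} := by
  obtain ⟨U, σ, V, hsvd, hUμ, hVμ⟩ := hμ.norm_le
  have hD : IsUnit (Matrix.diagonal fun k => (σ k : ℂ)) := by
    rw [Matrix.isUnit_diagonal, Pi.isUnit_iff]
    exact fun k => isUnit_iff_ne_zero.2 (by exact_mod_cast (hsvd.pos k).ne')
  have hVr : V.rank = r := rank_eq_of_conjTranspose_mul_self_eq_one hsvd.orthonormal_right
  have hr' : (1 : ℝ) ≤ r := by exact_mod_cast hr
  have hlog : 0 ≤ Real.log (2 * r / δ) :=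
    Real.log_nonneg (by rw [le_div_iff₀ hδ₀]; linarith)
  -- The logarithm is nonnegative and `ε² ≤ 1`, so the factor `3/ε²` can be dropped.
  have hsize : ∀ {μ x : ℝ}, 1 ≤ μ → 3 * r * μ * (Real.log (2 * r / δ) / ε ^ 2) ≤ x →
      r * μ * Real.log (2 * r / δ) ≤ x := fun {μ x} hμ hx => by
    have h1 : Real.log (2 * r / δ) ≤ Real.log (2 * r / δ) / ε ^ 2 :=
      le_div_self hlog (by positivity) (pow_le_one₀ hε₀.le hε₁.le)
    have h2 : r * μ * Real.log (2 * r / δ) ≤ r * μ * (Real.log (2 * r / δ) / ε ^ 2) := by gcongr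
    have h3 : 0 ≤ r * μ * Real.log (2 * r / δ) := by positivity
    linarith
  have hP := le_prob_rank_submatrix_eq hr (by omega) hsvd.orthonormal_left hμ.one_le_left hUμ hδ₀
    hmN (hsize hμ.one_le_left hm)
  have hQ := le_prob_rank_submatrix_eq hr (by omega) hsvd.orthonormal_right hμ.one_le_right hVμ hδ₀
    hnT (hsize hμ.one_le_right hn)
  constructor
  -- The column draw is unconstrained here: the product bound is applied with `F` the whole space.
  · have huniv : (sampleWithoutReplacement hnT).toOuterMeasure Set.univ = 1 :=
      (PMF.toOuterMeasure_apply_eq_one_iff _ _).2 (Set.subset_univ _)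
    refine hP.trans ?_
    rw [← mul_one (PMF.toOuterMeasure _ _), ← huniv]
    refine mul_toOuterMeasure_le_of_prod_subset _ _ fun p hp => ?_
    have heq : rowSubmatrix X p.1 = U.submatrix (Subtype.val : {i // i ∈ p.1} → Fin N) id *
        Matrix.diagonal (fun k => (σ k : ℂ)) * Vᴴ := by
      rw [hsvd.eq_mul]
      rfl
    rw [Set.mem_ofPred_eq, heq]
    exact rank_mul_mul_conjTranspose hp.1 hD hVr
  · rw [sq, ENNReal.ofReal_mul (by linarith)]
    refine (mul_le_mul' hP hQ).trans ?_
    refine mul_toOuterMeasure_le_of_prod_subset _ _ fun p hp => ?_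
    have heq : rowColSubmatrix X p.1 p.2 =
        U.submatrix (Subtype.val : {i // i ∈ p.1} → Fin N) id *
          Matrix.diagonal (fun k => (σ k : ℂ)) *
          (V.submatrix (Subtype.val : {j // j ∈ p.2} → Fin T) id)ᴴ := by
      rw [hsvd.eq_mul]
      rfl
    rw [Set.mem_ofPred_eq, heq]
    exact rank_mul_mul_conjTranspose hp.1 hD hp.2
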